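/- Let $a>-1$ and $\theta>0$ be real numbers and write $\mathbb{R}_+=(0,\infty)$. For an integer $N\ge 0$ define the partition function of the $\theta$-deformed Bures ensemble $$Z_N^B(a;\theta)=\frac1{N!}\int_{\mathbb{R}_+^N}\ \prod_{1\le j<k\le N}\frac{x_k-x_j}{x_k+x_j}\,(x_k^\theta-x_j^\theta)\ \prod_{j=1}^N x_j^a e^{-x_j}\,dx_j$$ and, for real $b$, the partition function of the $\theta$-deformed Cauchy--Laguerre two-matrix model $$Z_N^C(a,b;\theta)=\frac1{(N!)^2}\int_{\mathbb{R}_+^N\times\mathbb{R}_+^N}\ \prod_{j=1}^N x_j^a e^{-x_j}y_j^b e^{-y_j}\ \frac{\prod_{1\le j<k\le N}(x_k-x_j)(y_k-y_j)}{\prod_{j,k=1}^N(x_j+y_k)}\ \prod_{1\le j<k\le N}(x_k^\theta-x_j^\theta)(y_k^\theta-y_j^\theta)\,dx\,dy .$$ Then, for every $N\ge 0$, the integrals defining $Z_N^B(a;\theta)$ and $Z_N^C(a,a+1;\theta)$ converge absolutely, and $$\bigl(Z_N^B(a;\theta)\bigr)^2=2^N\,Z_N^C(a,a+1;\theta).$$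 Moreover, for all integers $j,k\ge 1$ the integrals $$I^C_{j,k}=\int_{\mathbb{R}_+^2}\frac{x^{a+\theta(j-1)}y^{a+1+\theta(k-1)}}{x+y}e^{-(x+y)}\,dx\,dy,\qquad I^B_{j,k}=\int_{\mathbb{R}_+^2}\frac{y-x}{y+x}\,x^{a+\theta(j-1)}y^{a+\theta(k-1)}e^{-(x+y)}\,dx\,dy,\qquad i^B_j=\int_{\mathbb{R}_+}x^{a+\theta(j-1)}e^{-x}\,dx$$ converge absolutely and satisfy $$2I^C_{j,k}=I^B_{j,k}+i^B_j\,i^B_k .$$ -/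

import Mathlib

open MeasureTheory

noncomputable section

namespace ThetaEnsemble

/-- The open orthant `(0,∞)^N`. -/
def orthant (N : ℕ) : Set (Fin N → ℝ) :=
  Set.univ.pi fun _ => Set.Ioi 0

/-- The open quadrant `(0,∞)²`. -/
def quadrant : Set (ℝ × ℝ) :=
  Set.Ioi 0 ×ˢ Set.Ioi 0

/-- The unnormalised density of the `θ`-deformed Bures ensemble with Laguerre weight. -/
def buresDensity (N : ℕ) (a θ : ℝ) (x : Fin N → ℝ) : ℝ :=
  (∏ j, ∏ k ∈ Finset.Ioi j, (x k - x j) / (x k + x j) * (x k ^ θ - x j ^ θ)) *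
    ∏ j, x j ^ a * Real.exp (-x j)

/-- The unnormalised density of the `θ`-deformed Cauchy–Laguerre two-matrix model. -/
def cauchyDensity (N : ℕ) (a b θ : ℝ) (p : (Fin N → ℝ) × (Fin N → ℝ)) : ℝ :=
  (∏ j, p.1 j ^ a * Real.exp (-p.1 j) * (p.2 j ^ b * Real.exp (-p.2 j))) *
    ((∏ j, ∏ k ∈ Finset.Ioi j, (p.1 k - p.1 j) * (p.2 k - p.2 j)) /
      ∏ j, ∏ k, (p.1 j + p.2 k)) *
    ∏ j, ∏ k ∈ Finset.Ioi j, (p.1 k ^ θ - p.1 j ^ θ) * (p.2 k ^ θ - p.2 j ^ θ)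

/-- The Bures partition function `Z_N^B(a;θ)`. -/
def buresZ (N : ℕ) (a θ : ℝ) : ℝ :=
  1 / (N.factorial : ℝ) * ∫ x in orthant N, buresDensity N a θ x

/-- The Cauchy–Laguerre partition function `Z_N^C(a,b;θ)`. -/
def cauchyZ (N : ℕ) (a b θ : ℝ) : ℝ :=
  (1 / (N.factorial : ℝ)) ^ 2 *
    ∫ p in orthant N ×ˢ orthant N, cauchyDensity N a b θ p

/-- Integrand of the bimoment `I^C_{j,k}(a,b;θ)`, with indices `j, k` starting from `1`. -/
def cauchyMomentIntegrand (a b θ : ℝ) (j k : ℕ) (p : ℝ × ℝ) : ℝ :=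
  p.1 ^ (a + θ * ((j : ℝ) - 1)) * p.2 ^ (b + θ * ((k : ℝ) - 1)) / (p.1 + p.2) *
    Real.exp (-(p.1 + p.2))

/-- Integrand of the bimoment `I^B_{j,k}(a;θ)`, with indices `j, k` starting from `1`. -/
def buresMomentIntegrand (a θ : ℝ) (j k : ℕ) (p : ℝ × ℝ) : ℝ :=
  (p.2 - p.1) / (p.2 + p.1) *
    (p.1 ^ (a + θ * ((j : ℝ) - 1)) * p.2 ^ (a + θ * ((k : ℝ) - 1))) *
    Real.exp (-(p.1 + p.2))

/-- Integrand of the single moment `i^B_j(a;θ)`, with the index `j` starting from `1`. -/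
def buresSingleIntegrand (a θ : ℝ) (j : ℕ) (x : ℝ) : ℝ :=
  x ^ (a + θ * ((j : ℝ) - 1)) * Real.exp (-x)

/-- The bimoment `I^C_{j,k}(a,b;θ)`. -/
def cauchyMoment (a b θ : ℝ) (j k : ℕ) : ℝ :=
  ∫ p in quadrant, cauchyMomentIntegrand a b θ j k p

/-- The bimoment `I^B_{j,k}(a;θ)`. -/
def buresMoment (a θ : ℝ) (j k : ℕ) : ℝ :=
  ∫ p in quadrant, buresMomentIntegrand a θ j k p

/-- The single moment `i^B_j(a;θ)`. -/
def buresSingleMoment (a θ : ℝ) (j : ℕ) : ℝ :=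
  ∫ x in Set.Ioi (0 : ℝ), buresSingleIntegrand a θ j x

end ThetaEnsemble

end

/-!
Write `S(x, y) = (y - x) / (y + x)`. For an even number of points, Schur's identity says that
`∏_{i < j} S(x i, x j)` is the Pfaffian of the matrix `S(x i, x j)`; it follows from
`∑ i, ∏_{k ≠ i} (z i + z k) / (z i - z k) = 0`, and an odd number of points reduces to an even one
by adding the point `0`, where `S(0, y) = 1`. Integrating the row expansion of this Pfaffian term
by term shows that the integrals of `∏_{i < j} S(x i, x j)` against `∏ i, f i (x i)` are the
Pfaffian minors of the skew-symmetric matrix `B` of the pairings of the `f i` with kernel `S`,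
bordered by the vector `u` of the integrals of the `f i` when the number of points is odd. In both
cases the square of such an integral is `det (B + u uᵀ)`, and `B + u uᵀ` is the matrix of the
pairings with kernel `1 + S`. By Andréief's identity the same determinant is the integral of two
alternants against `det (1 + S(x i, y j))`. Since `1 + S(x, y) = 2 y / (x + y)`, this last
determinant is a Cauchy determinant times `2 ^ N ∏ j, y j`, which raises the exponent of the second
weight from `a` to `a + 1`.
-/

noncomputable section

namespace ThetaEnsemble

section RationalIdentity

open Finset Polynomial

variable {K : Type*} [Field K] {ι : Type*} {s : Finset ι}

theorem prod_X_add_C_comp_neg_X (hs : Even #s) (z : ι → K) :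
    (∏ k ∈ s, (X + C (z k))).comp (-X) = ∏ k ∈ s, (X - C (z k)) := by
  rw [Polynomial.prod_comp, ← one_mul (∏ k ∈ s, _), ← hs.neg_one_pow, ← prod_const,
    ← prod_mul_distrib]
  refine prod_congr rfl fun k _ => ?_
  simp only [add_comp, X_comp, C_comp]
  ring

theorem degree_prod_X_add_C_sub_prod_X_sub_C_lt (s : Finset ι) (z : ι → K) :
    (∏ k ∈ s, (X + C (z k)) - ∏ k ∈ s, (X - C (z k))).degree < (#s : WithBot ℕ) := by
  have hadd : (∏ k ∈ s, (X + C (z k))).Monic := monic_prod_of_monic _ _ fun k _ => monic_X_add_C _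
  have hsub : (∏ k ∈ s, (X - C (z k))).Monic := monic_prod_of_monic _ _ fun k _ => monic_X_sub_C _
  have hadd_degree : (∏ k ∈ s, (X + C (z k))).degree = (#s : WithBot ℕ) := by simp [degree_prod]
  have hsub_degree : (∏ k ∈ s, (X - C (z k))).degree = (#s : WithBot ℕ) := by simp [degree_prod]
  rw [← hadd_degree]
  exact degree_sub_lt_left (hadd_degree.trans hsub_degree.symm) hadd.ne_zero
    (hadd.leadingCoeff.trans hsub.leadingCoeff.symm)

variable [DecidableEq ι]

theorem eval_eq_two_mul_prod_of_X_mul_eq {z : ι → K} {p : K[X]}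
    (hp : X * p = ∏ k ∈ s, (X + C (z k)) - (∏ k ∈ s, (X + C (z k))).comp (-X))
    {i : ι} (hi : i ∈ s) : p.eval (z i) = 2 * ∏ k ∈ s.erase i, (z i + z k) := by
  let M : K[X] := ∏ k ∈ s.erase i, (X + C (z k))
  obtain ⟨q, hq⟩ : X ∣ M - M.comp (-X) := by simp [X_dvd_iff, coeff_zero_eq_eval_zero]
  have hpq : p = M + M.comp (-X) + C (z i) * q := by
    refine mul_left_cancel₀ X_ne_zero ?_
    rw [hp, ← mul_prod_erase s _ hi, mul_comp, add_comp, X_comp, C_comp]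
    linear_combination C (z i) * hq
  have hM : M.eval (z i) = ∏ k ∈ s.erase i, (z i + z k) := by simp [M, eval_prod]
  have hqz := congrArg (eval (z i)) hq
  simp only [eval_sub, eval_mul, eval_X] at hqz
  rw [hpq, ← hM]
  simp only [eval_add, eval_mul, eval_C, ← hqz]
  ring

/-- With `N = ∏ k, (X + z k)`, the polynomial `(N(X) - N(-X)) / X` has degree at most `#s - 2`
and the value `2 ∏_{k ≠ i} (z i + z k)` at `z i`: the sum is its vanishing coefficient of degree
`#s - 1`, read off from Lagrange interpolation. -/
theorem sum_prod_add_div_sub_eq_zero [NeZero (2 : K)] {z : ι → K}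
    (hz : Set.InjOn z s) (hs : Even #s) :
    ∑ i ∈ s, ∏ k ∈ s.erase i, (z i + z k) / (z i - z k) = 0 := by
  rcases s.eq_empty_or_nonempty with rfl | hne
  · simp
  obtain ⟨p, hp⟩ : X ∣ ∏ k ∈ s, (X + C (z k)) - (∏ k ∈ s, (X + C (z k))).comp (-X) := by
    simp [X_dvd_iff, coeff_zero_eq_eval_zero]
  have hp_degree : p.degree < (#s - 1 : ℕ) := by
    have hXp := degree_prod_X_add_C_sub_prod_X_sub_C_lt s z
    rw [← prod_X_add_C_comp_neg_X hs, hp, mul_comm, ← Nat.sub_add_cancel hne.card_pos] at hXp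
    rw [degree_mul_X] at hXp
    push_cast at hXp
    exact lt_of_add_lt_add_right hXp
  have hcoeff := Lagrange.coeff_eq_sum hz (hp_degree.trans_le (by norm_cast; omega))
  rw [coeff_eq_zero_of_degree_lt hp_degree] at hcoeff
  refine (mul_eq_zero.1 ?_).resolve_left (two_ne_zero (α := K))
  rw [hcoeff, mul_sum]
  refine sum_congr rfl fun i hi => ?_
  rw [eval_eq_two_mul_prod_of_X_mul_eq hp.symm hi, prod_div_distrib, mul_div_assoc]

theorem sum_prod_succAbove_add_div_sub_eq_zero [NeZero (2 : K)] {n : ℕ} (hn : Even n)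
    {z : Fin (n + 2) → K} (hz : Function.Injective z) :
    ∑ i, ∏ k, (z i + z (i.succAbove k)) / (z i - z (i.succAbove k)) = 0 := by
  rw [← sum_prod_add_div_sub_eq_zero hz.injOn (s := univ)
    (by simpa [Nat.even_add] using hn)]
  refine sum_congr rfl fun i _ => ?_
  have herase : univ.erase i = univ.map i.succAboveEmb := by
    ext k; simp [Fin.exists_succAbove_eq_iff]
  rw [herase, prod_map]
  rfl

end RationalIdentity

section Determinants

open Matrix

theorem det_eq_mul_det_sub_sum_mul_adjugate {R : Type*} [CommRing R] {m : ℕ}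
    (M : Matrix (Fin (m + 1)) (Fin (m + 1)) R) :
    M.det = M 0 0 * (M.submatrix Fin.succ Fin.succ).det -
      ∑ j, ∑ i, M 0 j.succ * (M.submatrix Fin.succ Fin.succ).adjugate j i * M i.succ 0 := by
  rw [det_succ_row_zero, Fin.sum_univ_succ, sub_eq_add_neg, ← Finset.sum_neg_distrib]
  congr 1
  · simp
  rcases m with _ | m
  · simp
  refine Finset.sum_congr rfl fun j _ => ?_
  rw [det_succ_column_zero, Finset.mul_sum, ← Finset.sum_neg_distrib]
  refine Finset.sum_congr rfl fun i _ => ?_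
  rw [adjugate_fin_succ_eq_det_submatrix]
  simp only [submatrix_apply, submatrix_submatrix, Fin.val_succ,
    Fin.succ_succAbove_zero, Function.comp_def, Fin.succ_succAbove_succ]
  ring

theorem det_add_vecMulVec {R : Type*} [CommRing R] {m : ℕ} (A : Matrix (Fin m) (Fin m) R)
    (u v : Fin m → R) :
    (A + vecMulVec u v).det = A.det + v ⬝ᵥ A.adjugate *ᵥ u := by
  let bordered : Matrix (Fin (m + 1)) (Fin (m + 1)) R :=
    of (Fin.cons (Fin.cons 1 (-v)) fun i => Fin.cons (u i) (A i))
  let eliminated : Matrix (Fin (m + 1)) (Fin (m + 1)) R :=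
    of (Fin.cons (Fin.cons 1 (-v)) fun i => Fin.cons 0 ((A + vecMulVec u v) i))
  have hcofactor : bordered.det = A.det + v ⬝ᵥ A.adjugate *ᵥ u := by
    have hminor : bordered.submatrix Fin.succ Fin.succ = A := by ext i j; simp [bordered]
    rw [det_eq_mul_det_sub_sum_mul_adjugate, hminor]
    simp [bordered, dotProduct, mulVec, Finset.mul_sum, mul_assoc]
  have helimination : bordered.det = eliminated.det := by
    refine det_eq_of_forall_row_eq_smul_add_const (Fin.cons 0 u) 0 (by simp) fun i j => ?_
    refine Fin.cases ?_ (fun i => ?_) i <;> refine Fin.cases ?_ (fun j => ?_) j <;>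
      simp [bordered, eliminated, vecMulVec_apply]
  have hminor : eliminated.submatrix Fin.succ Fin.succ = A + vecMulVec u v := by
    ext i j; simp [eliminated]
  rw [← hcofactor, helimination, det_eq_mul_det_sub_sum_mul_adjugate, hminor]
  simp [eliminated]

variable {n : Type*} [Fintype n] [DecidableEq n] {K : Type*} [Field K]

theorem mul_eq_mul_of_mulVec_eq_zero {A : Matrix n n K} {v w : n → K}
    (hv : A *ᵥ v = 0) (hw : A *ᵥ w = 0) {j k : n} (hjk : A.adjugate j k ≠ 0) (i : n) :
    v i * w j = v j * w i := by
  let z : n → K := w j • v - v j • w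
  have hz : A *ᵥ z = 0 := by simp [z, mulVec_sub, mulVec_smul, hv, hw]
  have hz' : A.updateRow k (Pi.single j 1) *ᵥ z = 0 := by
    ext i
    rcases eq_or_ne i k with rfl | hik
    · simp [mulVec, z, mul_comm]
    · simpa [mulVec, hik] using congrFun hz i
  have hzi := congrFun (eq_zero_of_mulVec_eq_zero (adjugate_apply A j k ▸ hjk) hz') i
  simp only [z, Pi.sub_apply, Pi.smul_apply, smul_eq_mul, Pi.zero_apply] at hzi
  linear_combination hzi

variable [NeZero (2 : K)] {A : Matrix n n K}

theorem det_eq_zero_of_transpose_eq_neg (hA : Aᵀ = -A) (hn : Odd (Fintype.card n)) :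
    A.det = 0 := by
  have h := congrArg det hA
  rw [det_transpose, det_neg, hn.neg_one_pow] at h
  refine (mul_eq_zero.1 (?_ : (2 : K) * A.det = 0)).resolve_left two_ne_zero
  linear_combination h

theorem transpose_adjugate_of_transpose_eq_neg {R : Type*} [CommRing R] {A : Matrix n n R}
    (hA : Aᵀ = -A) : A.adjugateᵀ = (-1 : R) ^ (Fintype.card n - 1) • A.adjugate := by
  rw [adjugate_transpose, hA, ← neg_one_smul R A, adjugate_smul]

theorem dotProduct_adjugate_mulVec_self_eq_zero (hA : Aᵀ = -A) (hn : Even (Fintype.card n))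
    (u : n → K) : u ⬝ᵥ A.adjugate *ᵥ u = 0 := by
  rcases isEmpty_or_nonempty n
  · simp
  have hodd : Odd (Fintype.card n - 1) := Nat.Even.sub_odd Fintype.card_pos hn odd_one
  have hadj : A.adjugateᵀ = -A.adjugate := by
    rw [transpose_adjugate_of_transpose_eq_neg hA, hodd.neg_one_pow, neg_one_smul]
  have h : u ⬝ᵥ A.adjugate *ᵥ u = -(u ⬝ᵥ A.adjugate *ᵥ u) := by
    rw [← dotProduct_neg, ← neg_mulVec, ← hadj, mulVec_transpose, dotProduct_comm u (u ᵥ* _),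
      dotProduct_mulVec]
  refine (mul_eq_zero.1 (?_ : (2 : K) * (u ⬝ᵥ A.adjugate *ᵥ u) = 0)).resolve_left two_ne_zero
  linear_combination h

theorem mulVec_adjugate_col_eq_zero {R : Type*} [CommRing R] {A : Matrix n n R} (hA : A.det = 0)
    (j : n) : A *ᵥ A.adjugate.col j = 0 := by
  have h := mul_adjugate A
  rw [hA, zero_smul] at h
  ext i
  exact congrFun (congrFun h i) j

theorem adjugate_eq_vecMulVec_of_mulVec_eq_zero (hA : Aᵀ = -A) (hn : Odd (Fintype.card n))
    {w : n → K} (hw : A *ᵥ w = 0) (hdiag : ∀ i, A.adjugate i i = w i ^ 2) :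
    A.adjugate = vecMulVec w w := by
  have hsymm : A.adjugateᵀ = A.adjugate := by
    rw [transpose_adjugate_of_transpose_eq_neg hA, (Nat.Odd.sub_odd hn odd_one).neg_one_pow,
      one_smul]
  have hcolumn := mulVec_adjugate_col_eq_zero (det_eq_zero_of_transpose_eq_neg hA hn)
  have hne {j : n} (hj : A.adjugate j j ≠ 0) (i : n) : A.adjugate i j = w i * w j := by
    have h := mul_eq_mul_of_mulVec_eq_zero (hcolumn j) hw hj i
    have hwj : w j ≠ 0 := fun h0 => hj (by rw [hdiag, h0]; simp)
    refine mul_right_cancel₀ hwj (h.trans ?_)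
    rw [col_apply, hdiag]
    ring
  ext i j
  rw [vecMulVec_apply]
  by_cases hj : A.adjugate j j = 0
  · by_cases hi : A.adjugate i i = 0
    · by_contra hij
      have hij' : A.adjugate i j ≠ 0 := fun h0 => hij (by
        rw [h0, pow_eq_zero_iff two_ne_zero |>.1 ((hdiag i).symm.trans hi), zero_mul])
      have h := mul_eq_mul_of_mulVec_eq_zero (hcolumn i) (hcolumn j) hij' j
      rw [col_apply, col_apply, col_apply, hi, zero_mul, ← hsymm, transpose_apply] at h
      exact mul_ne_zero hij' (by rwa [← hsymm] at hij') h
    · rw [← hsymm, transpose_apply, hne hi, mul_comm]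
  · exact hne hj i

end Determinants

section PfaffianFamilies

open Matrix

variable {ι K : Type*} [Field K] {A : Matrix ι ι K} {Φ : ∀ n, (Fin n → ι) → K} {n : ℕ}

/-- A family that behaves like the Pfaffian minors of the skew-symmetric matrix `A`: for even `n`,
`Φ n e` plays the role of the Pfaffian of `A.submatrix e e`, characterised by its expansion along
the first row and its vanishing on repeated indices. Odd `n` are unconstrained. -/
structure IsPfaffianFamily (A : Matrix ι ι K) (Φ : ∀ n, (Fin n → ι) → K) : Prop where
  transpose_eq_neg : Aᵀ = -A
  empty : ∀ e, Φ 0 e = 1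
  expand : ∀ {n}, Even n → ∀ e : Fin (n + 2) → ι, Φ (n + 2) e =
    ∑ j : Fin (n + 1), (-1) ^ (j : ℕ) * A (e 0) (e j.succ) * Φ n fun k => e (j.succAbove k).succ
  eq_zero_of_eq : ∀ {n} (e : Fin (n + 2) → ι) (j : Fin (n + 1)), e 0 = e j.succ → Φ (n + 2) e = 0

/-- The values of `Φ` with one index left out, with the signs of a row expansion. -/
def signedMinors (Φ : ∀ n, (Fin n → ι) → K) (e : Fin (n + 1) → ι) (j : Fin (n + 1)) : K :=
  (-1) ^ (j : ℕ) * Φ n fun k => e (j.succAbove k)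

namespace IsPfaffianFamily

theorem sum_mul_signedMinors (h : IsPfaffianFamily A Φ) (hn : Even n) (e : Fin (n + 2) → ι) :
    ∑ j, A (e 0) (e j.succ) * signedMinors Φ (fun k => e k.succ) j = Φ (n + 2) e := by
  rw [h.expand hn]
  refine Finset.sum_congr rfl fun j _ => ?_
  rw [signedMinors]
  ring

theorem submatrix_mulVec_signedMinors_eq_zero (h : IsPfaffianFamily A Φ) (hn : Even n)
    (e : Fin (n + 1) → ι) : A.submatrix e e *ᵥ signedMinors Φ e = 0 := by
  ext i
  let e' : Fin (n + 2) → ι := Fin.cons (e i) e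
  exact (h.sum_mul_signedMinors hn e').trans (h.eq_zero_of_eq e' i rfl)

theorem transpose_submatrix_eq_neg (h : IsPfaffianFamily A Φ) {κ : Type*} (e : κ → ι) :
    (A.submatrix e e)ᵀ = -A.submatrix e e := by
  rw [transpose_submatrix, h.transpose_eq_neg, submatrix_neg]; rfl

variable [NeZero (2 : K)]

theorem diag_eq_zero (h : IsPfaffianFamily A Φ) (i : ι) : A i i = 0 := by
  refine (mul_eq_zero.1 (?_ : (2 : K) * A i i = 0)).resolve_left two_ne_zero
  have hii := congrFun (congrFun h.transpose_eq_neg i) i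
  rw [transpose_apply, neg_apply] at hii
  linear_combination hii

theorem adjugate_submatrix_eq (h : IsPfaffianFamily A Φ) (hn : Even n)
    (hsq : ∀ e : Fin n → ι, (A.submatrix e e).det = Φ n e ^ 2) (e : Fin (n + 1) → ι) :
    (A.submatrix e e).adjugate = vecMulVec (signedMinors Φ e) (signedMinors Φ e) := by
  refine adjugate_eq_vecMulVec_of_mulVec_eq_zero (h.transpose_submatrix_eq_neg e)
    (by simpa using hn.add_one) (h.submatrix_mulVec_signedMinors_eq_zero hn e) fun i => ?_
  rw [adjugate_fin_succ_eq_det_submatrix, submatrix_submatrix]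
  refine (congrArg _ (hsq (e ∘ i.succAbove))).trans ?_
  rw [signedMinors, mul_pow, ← pow_mul, mul_comm (i : ℕ) 2, two_mul]
  rfl

theorem det_submatrix_eq_sq (h : IsPfaffianFamily A Φ) (hn : Even n) (e : Fin n → ι) :
    (A.submatrix e e).det = Φ n e ^ 2 := by
  induction n using Nat.twoStepInduction with
  | zero => simp [h.empty]
  | one => exact absurd hn Nat.not_even_one
  | more n ih _ =>
    have hn : Even n := by simpa [Nat.even_add] using hn
    have hskew (i : Fin (n + 2)) : A (e i) (e 0) = -A (e 0) (e i) :=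
      congrFun (congrFun h.transpose_eq_neg (e 0)) (e i)
    rw [det_eq_mul_det_sub_sum_mul_adjugate, submatrix_submatrix,
      h.adjugate_submatrix_eq hn (ih hn), submatrix_apply, h.diag_eq_zero, zero_mul, zero_sub,
      ← h.sum_mul_signedMinors hn, sq, Finset.sum_mul_sum, ← Finset.sum_neg_distrib]
    refine Finset.sum_congr rfl fun j _ => ?_
    rw [← Finset.sum_neg_distrib]
    refine Finset.sum_congr rfl fun i _ => ?_
    rw [vecMulVec_apply, submatrix_apply, submatrix_apply, hskew]
    simp only [Function.comp_def]
    ring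

theorem det_submatrix_add_vecMulVec_of_even (h : IsPfaffianFamily A Φ) (hn : Even n) (u : ι → K)
    (e : Fin n → ι) : ((A + vecMulVec u u).submatrix e e).det = Φ n e ^ 2 := by
  have hsum : (A + vecMulVec u u).submatrix e e =
      A.submatrix e e + vecMulVec (u ∘ e) (u ∘ e) := rfl
  rw [hsum, det_add_vecMulVec, dotProduct_adjugate_mulVec_self_eq_zero
    (h.transpose_submatrix_eq_neg e) (by simpa using hn), add_zero, h.det_submatrix_eq_sq hn]

theorem det_submatrix_add_vecMulVec_of_odd (h : IsPfaffianFamily A Φ) (hn : Even n) (u : ι → K)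
    (e : Fin (n + 1) → ι) : ((A + vecMulVec u u).submatrix e e).det =
      (∑ j, u (e j) * signedMinors Φ e j) ^ 2 := by
  have hsum : (A + vecMulVec u u).submatrix e e =
      A.submatrix e e + vecMulVec (u ∘ e) (u ∘ e) := rfl
  rw [hsum, det_add_vecMulVec, det_eq_zero_of_transpose_eq_neg (h.transpose_submatrix_eq_neg e)
    (by simpa using hn.add_one), zero_add, h.adjugate_submatrix_eq hn (h.det_submatrix_eq_sq hn),
    vecMulVec_mulVec, dotProduct_smul, dotProduct_comm (signedMinors Φ e)]
  exact (sq _).symm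

end IsPfaffianFamily

end PfaffianFamilies

section CauchyDeterminant

open Matrix

variable {K : Type*} [Field K]

/-- Row elimination: subtracting the multiple `(x 0 + y 0) / (x i + y 0)` of the first row from row
`i` clears the first column and leaves a rescaled Cauchy matrix. -/
theorem det_cauchy_succ {n : ℕ} (x y : Fin (n + 1) → K) (h : ∀ i j, x i + y j ≠ 0) :
    (of fun i j => (x i + y j)⁻¹).det = (x 0 + y 0)⁻¹ *
      ((∏ i : Fin n, (x i.succ - x 0) / (x i.succ + y 0)) *
        ((∏ j : Fin n, (y j.succ - y 0) / (x 0 + y j.succ)) *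
          (of fun i j : Fin n => (x i.succ + y j.succ)⁻¹).det)) := by
  let c : Fin (n + 1) → K := Fin.cons 0 fun i => (x 0 + y 0) / (x i.succ + y 0)
  let B : Matrix (Fin (n + 1)) (Fin (n + 1)) K :=
    of fun i j => (x i + y j)⁻¹ - c i * (x 0 + y j)⁻¹
  have hcolumn (i : Fin n) : B i.succ 0 = 0 := by
    have := h 0 0
    have := h i.succ 0
    simp only [B, c, of_apply, Fin.cons_succ]
    field_simp
    ring
  have hminor : B.submatrix Fin.succ Fin.succ = of fun i j =>
      (x i.succ - x 0) / (x i.succ + y 0) *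
        of (fun i j => (y j.succ - y 0) / (x 0 + y j.succ) *
          of (fun i j => (x i.succ + y j.succ)⁻¹) i j) i j := by
    ext i j
    have := h i.succ j.succ
    have := h i.succ 0
    have := h 0 j.succ
    simp only [B, c, submatrix_apply, of_apply, Fin.cons_succ]
    field_simp
    ring
  rw [det_eq_of_forall_row_eq_smul_add_const (B := B) c 0 rfl fun i j => by simp [B, c],
    det_succ_column_zero, Fin.sum_univ_succ]
  simp only [hcolumn, mul_zero, zero_mul, Finset.sum_const_zero, add_zero]
  rw [← det_mul_row, ← det_mul_column, ← hminor]
  simp [B, c]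

theorem det_cauchy {n : ℕ} (x y : Fin n → K) (h : ∀ i j, x i + y j ≠ 0) :
    (of fun i j => (x i + y j)⁻¹).det =
      (∏ i, ∏ j ∈ Finset.Ioi i, (x j - x i) * (y j - y i)) / ∏ i, ∏ j, (x i + y j) := by
  induction n with
  | zero => simp
  | succ n ih =>
    rw [det_cauchy_succ x y h, ih _ _ fun i j => h _ _]
    simp only [Fin.prod_univ_succ, Fin.prod_Ioi_zero, Fin.prod_Ioi_succ, Finset.prod_mul_distrib,
      Finset.prod_inv_distrib, div_eq_mul_inv, mul_inv]
    ring

end CauchyDeterminant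

section PairProd

variable {X R : Type*} [CommRing R] {n : ℕ}

/-- The product of `S (x i) (x j)` over all pairs `i < j`: the interaction of the Bures ensemble,
and a Pfaffian when `S` is the Schur kernel. -/
def pairProd (S : X → X → R) (x : Fin n → X) : R :=
  ∏ i, ∏ j ∈ Finset.Ioi i, S (x i) (x j)

theorem pairProd_succ (S : X → X → R) (x : Fin (n + 1) → X) :
    pairProd S x = (∏ j : Fin n, S (x 0) (x j.succ)) * pairProd S (fun j : Fin n => x j.succ) := by
  simp [pairProd, Fin.prod_univ_succ]

theorem pairProd_comp_perm {S : X → X → R} (hS : ∀ x y, S x y = -S y x)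
    (σ : Equiv.Perm (Fin n)) (x : Fin n → X) :
    pairProd S (x ∘ σ) = (Equiv.Perm.sign σ : ℤ) * pairProd S x :=
  σ.prod_Ioi_comp_eq_sign_mul_prod (f := fun i j => S (x i) (x j)) fun _ _ => hS _ _

theorem pairProd_eq_extract {S : X → X → R} (hS : ∀ x y, S x y = -S y x)
    (x : Fin (n + 1) → X) (j : Fin (n + 1)) :
    pairProd S x = (-1) ^ (j : ℕ) * (∏ k : Fin n, S (x j) (x (j.succAbove k))) *
      pairProd S (fun k => x (j.succAbove k)) := by
  have h := pairProd_comp_perm hS j.cycleRange.symm x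
  rw [pairProd_succ] at h
  simp only [Function.comp_apply, Fin.cycleRange_symm_zero, Fin.cycleRange_symm_succ,
    Equiv.Perm.sign_symm, Fin.sign_cycleRange] at h
  push_cast at h
  rw [mul_assoc, h, ← mul_assoc, ← mul_pow]
  simp

end PairProd

section Antisymmetrization

variable {Ω : Type*} [MeasurableSpace Ω] {ν : Measure Ω} {n : Type*} [Fintype n] [DecidableEq n]
  {T : Equiv.Perm n → Ω ≃ᵐ Ω} {F : Ω → ℝ} {M : Ω → Matrix n n ℝ}

theorem mul_det_eq_sum_comp (hF : ∀ σ ω, F (T σ ω) = (Equiv.Perm.sign σ : ℤ) * F ω)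
    (hM : ∀ σ ω, M (T σ ω) = (M ω).submatrix σ id) (ω : Ω) :
    F ω * (M ω).det = ∑ σ, F (T σ ω) * ∏ i, M (T σ ω) i i := by
  rw [Matrix.det_apply', Finset.mul_sum]
  refine Finset.sum_congr rfl fun σ _ => ?_
  simp only [hF, hM, Matrix.submatrix_apply, id]
  ring

theorem integrable_mul_det (hT : ∀ σ, MeasurePreserving (T σ) ν ν)
    (hF : ∀ σ ω, F (T σ ω) = (Equiv.Perm.sign σ : ℤ) * F ω)
    (hM : ∀ σ ω, M (T σ ω) = (M ω).submatrix σ id)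
    (hint : Integrable (fun ω => F ω * ∏ i, M ω i i) ν) :
    Integrable (fun ω => F ω * (M ω).det) ν := by
  simp only [mul_det_eq_sum_comp hF hM]
  exact integrable_finsetSum _ fun σ _ => (hT σ).integrable_comp_of_integrable hint

theorem integral_mul_det (hT : ∀ σ, MeasurePreserving (T σ) ν ν)
    (hF : ∀ σ ω, F (T σ ω) = (Equiv.Perm.sign σ : ℤ) * F ω)
    (hM : ∀ σ ω, M (T σ ω) = (M ω).submatrix σ id)
    (hint : Integrable (fun ω => F ω * ∏ i, M ω i i) ν) :
    ∫ ω, F ω * (M ω).det ∂ν =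
      (Fintype.card n).factorial * ∫ ω, F ω * ∏ i, M ω i i ∂ν := by
  let D : Ω → ℝ := fun ω => F ω * ∏ i, M ω i i
  calc ∫ ω, F ω * (M ω).det ∂ν
    _ = ∫ ω, ∑ σ, D (T σ ω) ∂ν := by simp only [mul_det_eq_sum_comp hF hM, D]
    _ = ∑ σ, ∫ ω, D (T σ ω) ∂ν :=
      integral_finsetSum _ fun σ _ => (hT σ).integrable_comp_of_integrable hint
    _ = ∑ _σ : Equiv.Perm n, ∫ ω, D ω ∂ν :=
      Finset.sum_congr rfl fun σ _ => (hT σ).integral_comp' D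
    _ = (Fintype.card n).factorial * ∫ ω, D ω ∂ν := by simp [Fintype.card_perm]

end Antisymmetrization

section ProductMeasures

variable {X : Type*} [MeasurableSpace X]

/-- The action `x ↦ x ∘ σ` of a permutation on the coordinates, a symmetry of every power
measure. -/
def permCoord {ι : Type*} (σ : Equiv.Perm ι) : (ι → X) ≃ᵐ (ι → X) :=
  MeasurableEquiv.arrowCongr' σ.symm (MeasurableEquiv.refl X)

theorem permCoord_apply {ι : Type*} (σ : Equiv.Perm ι) (x : ι → X) : permCoord σ x = x ∘ σ :=
  rfl

variable (μ : Measure X) [SigmaFinite μ] {n : ℕ}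

theorem measurePreserving_permCoord {ι : Type*} [Fintype ι] (σ : Equiv.Perm ι) :
    MeasurePreserving (permCoord σ) (Measure.pi fun _ => μ) (Measure.pi fun _ => μ) :=
  measurePreserving_arrowCongr' (fun _ => μ) (fun _ => μ) σ.symm (MeasurableEquiv.refl X)
    fun _ => MeasurePreserving.id μ

theorem ae_injective_pi [MeasurableEq X] [NullSingletonClass μ] :
    ∀ᵐ x ∂(Measure.pi fun _ : Fin n => μ), Function.Injective x := by
  have hne (i j : Fin n) (hij : j ≠ i) : ∀ᵐ x ∂(Measure.pi fun _ : Fin n => μ), x i ≠ x j := by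
    obtain ⟨m, rfl⟩ : ∃ m, n = m + 1 := ⟨n - 1, (Nat.succ_pred_eq_of_pos i.pos).symm⟩
    obtain ⟨k, rfl⟩ := Fin.exists_succAbove_eq hij
    have hmeas : MeasurableSet {p : X × (Fin m → X) | p.1 = p.2 k} :=
      measurableSet_eq_fun measurable_fst ((measurable_pi_apply k).comp measurable_snd)
    have hpair : ∀ᵐ p ∂(μ.prod (Measure.pi fun _ : Fin m => μ)), p.1 ≠ p.2 k :=
      (Measure.ae_prod_iff_ae_ae hmeas.compl).2 <| Filter.Eventually.of_forall fun a =>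
        (Measure.ae_eval_ne (fun _ => μ) k a).mono fun _ h => Ne.symm h
    exact (measurePreserving_piFinSuccAbove (fun _ : Fin (m + 1) => μ) i).quasiMeasurePreserving.ae
      hpair
  have hall : ∀ᵐ x ∂(Measure.pi fun _ : Fin n => μ), ∀ i j, j ≠ i → x i ≠ x j :=
    ae_all_iff.2 fun i => ae_all_iff.2 fun j => Filter.eventually_imp_distrib_left.2 (hne i j)
  filter_upwards [hall] with x hx i j hxij
  by_contra hij
  exact hx i j (Ne.symm hij) hxij

/-- Separation of the coordinates `0` and `j.succ` from the others, which splits the terms of a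
Pfaffian row expansion into independent factors. -/
def splitZeroSucc (j : Fin (n + 1)) : (Fin (n + 2) → X) ≃ᵐ (X × X) × (Fin n → X) :=
  (MeasurableEquiv.piFinSuccAbove (fun _ => X) 0).trans
    (((MeasurableEquiv.refl X).prodCongr (MeasurableEquiv.piFinSuccAbove (fun _ => X) j)).trans
      MeasurableEquiv.prodAssoc.symm)

theorem measurePreserving_splitZeroSucc (j : Fin (n + 1)) :
    MeasurePreserving (splitZeroSucc j) (Measure.pi fun _ => μ)
      ((μ.prod μ).prod (Measure.pi fun _ => μ)) :=
  ((measurePreserving_prodAssoc μ μ (Measure.pi fun _ : Fin n => μ)).symm _).comp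
    (((MeasurePreserving.id μ).prod
      (measurePreserving_piFinSuccAbove (fun _ : Fin (n + 1) => μ) j)).comp
        (measurePreserving_piFinSuccAbove (fun _ : Fin (n + 2) => μ) 0))

variable {μ}

theorem integrable_pi_mul_succAbove (j : Fin (n + 1)) {f : X → ℝ} {G : (Fin n → X) → ℝ}
    (hf : Integrable f μ) (hG : Integrable G (Measure.pi fun _ => μ)) :
    Integrable (fun x => f (x j) * G fun k => x (j.succAbove k)) (Measure.pi fun _ => μ) :=
  (measurePreserving_piFinSuccAbove (fun _ : Fin (n + 1) => μ) j).integrable_comp_of_integrable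
    (hf.mul_prod hG)

theorem integral_pi_mul_succAbove (j : Fin (n + 1)) (f : X → ℝ) (G : (Fin n → X) → ℝ) :
    ∫ x, f (x j) * G (fun k => x (j.succAbove k)) ∂(Measure.pi fun _ => μ) =
      (∫ x, f x ∂μ) * ∫ x, G x ∂(Measure.pi fun _ => μ) :=
  ((measurePreserving_piFinSuccAbove (fun _ : Fin (n + 1) => μ) j).integral_comp'
    fun p => f p.1 * G p.2).trans (integral_prod_mul f G)

theorem integrable_pi_mul_zero_succ (j : Fin (n + 1)) {H : X × X → ℝ} {G : (Fin n → X) → ℝ}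
    (hH : Integrable H (μ.prod μ)) (hG : Integrable G (Measure.pi fun _ => μ)) :
    Integrable (fun x => H (x 0, x j.succ) * G fun k => x (j.succAbove k).succ)
      (Measure.pi fun _ => μ) :=
  (measurePreserving_splitZeroSucc μ j).integrable_comp_of_integrable (hH.mul_prod hG)

theorem integral_pi_mul_zero_succ (j : Fin (n + 1)) (H : X × X → ℝ) (G : (Fin n → X) → ℝ) :
    ∫ x, H (x 0, x j.succ) * G (fun k => x (j.succAbove k).succ) ∂(Measure.pi fun _ => μ) =
      (∫ p, H p ∂(μ.prod μ)) * ∫ x, G x ∂(Measure.pi fun _ => μ) :=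
  ((measurePreserving_splitZeroSucc μ j).integral_comp' fun p => H p.1 * G p.2).trans
    (integral_prod_mul H G)

theorem det_of_rows_eq_sum {Y : Type*} (h : Fin n → Fin n → Y → ℝ) (y : Fin n → Y) :
    (Matrix.of fun i j => h i j (y i)).det =
      ∑ σ : Equiv.Perm (Fin n), ((Equiv.Perm.sign σ : ℤ) : ℝ) * ∏ i, h i (σ i) (y i) := by
  rw [← Matrix.det_transpose, Matrix.det_apply']
  rfl

theorem integrable_det_of_rows {h : Fin n → Fin n → X → ℝ} (hint : ∀ i j, Integrable (h i j) μ) :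
    Integrable (fun x => (Matrix.of fun i j => h i j (x i)).det) (Measure.pi fun _ => μ) := by
  simp only [det_of_rows_eq_sum]
  exact integrable_finsetSum _ fun σ _ =>
    (Integrable.fintype_prod fun i => hint i (σ i)).const_mul _

theorem integral_det_of_rows {h : Fin n → Fin n → X → ℝ} (hint : ∀ i j, Integrable (h i j) μ) :
    ∫ x, (Matrix.of fun i j => h i j (x i)).det ∂(Measure.pi fun _ => μ) =
      (Matrix.of fun i j => ∫ x, h i j x ∂μ).det := by
  simp only [det_of_rows_eq_sum]
  rw [integral_finsetSum _ fun σ _ =>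
    (Integrable.fintype_prod fun i => hint i (σ i)).const_mul _, ← Matrix.det_transpose,
    Matrix.det_apply']
  refine Finset.sum_congr rfl fun σ _ => ?_
  rw [integral_const_mul, integral_fintype_prod_eq_prod]
  rfl

end ProductMeasures

section Andreief

variable {X : Type*} {n : ℕ}

/-- The alternant `det (f j (x i))`, which generalises the Vandermonde determinant. -/
def alternant (f : Fin n → X → ℝ) (x : Fin n → X) : ℝ :=
  (Matrix.of fun i j => f j (x i)).det

/-- The matrix `K (x i) (y j)` coupling two systems of points, given as a pair `(x, y)`. -/
def kernelMatrix (K : X → X → ℝ) (p : (Fin n → X) × (Fin n → X)) : Matrix (Fin n) (Fin n) ℝ :=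
  Matrix.of fun i j => K (p.1 i) (p.2 j)

theorem alternant_comp_perm (f : Fin n → X → ℝ) (σ : Equiv.Perm (Fin n)) (x : Fin n → X) :
    alternant f (x ∘ σ) = (Equiv.Perm.sign σ : ℤ) * alternant f x :=
  Matrix.det_permute σ (Matrix.of fun i j => f j (x i))

variable {K : X → X → ℝ} {f g : Fin n → X → ℝ}

theorem prod_kernel_mul_alternant_mul_prod (p : (Fin n → X) × (Fin n → X)) :
    (∏ i, K (p.1 i) (p.2 i)) * alternant g p.2 * ∏ i, f i (p.1 i) =
      (Matrix.of fun i j => K (p.1 i) (p.2 i) * (f i (p.1 i) * g j (p.2 i))).det := by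
  rw [mul_right_comm, ← Finset.prod_mul_distrib, alternant, ← Matrix.det_mul_column]
  simp only [Matrix.of_apply, mul_assoc]

theorem prod_kernel_mul_alternant_mul_alternant (p : (Fin n → X) × (Fin n → X)) :
    (∏ i, K (p.1 i) (p.2 i)) * alternant g p.2 * alternant f p.1 =
      alternant g p.2 * alternant f p.1 * ∏ i, kernelMatrix K p i i := by
  rw [mul_comm _ (∏ i, kernelMatrix K p i i), mul_assoc]
  rfl

variable [MeasurableSpace X]

/-- The bilinear pairing of two functions with kernel `K`. -/
def kernelPairing (μ : Measure X) (K : X → X → ℝ) (f g : X → ℝ) : ℝ :=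
  ∫ p, K p.1 p.2 * (f p.1 * g p.2) ∂(μ.prod μ)

variable {μ : Measure X} [SigmaFinite μ]

theorem integrable_prod_kernel_mul_alternant_mul_prod
    (hint : ∀ i j, Integrable (fun q : X × X => K q.1 q.2 * (f i q.1 * g j q.2)) (μ.prod μ)) :
    Integrable (fun p : (Fin n → X) × (Fin n → X) =>
        (∏ i, K (p.1 i) (p.2 i)) * alternant g p.2 * ∏ i, f i (p.1 i))
      ((Measure.pi fun _ => μ).prod (Measure.pi fun _ => μ)) := by
  simp only [prod_kernel_mul_alternant_mul_prod]
  exact ((measurePreserving_arrowProdEquivProdArrow X X (Fin n) (fun _ => μ)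
    fun _ => μ).symm _).integrable_comp_of_integrable (integrable_det_of_rows hint)

theorem integral_prod_kernel_mul_alternant_mul_prod
    (hint : ∀ i j, Integrable (fun q : X × X => K q.1 q.2 * (f i q.1 * g j q.2)) (μ.prod μ)) :
    ∫ p, (∏ i, K (p.1 i) (p.2 i)) * alternant g p.2 * ∏ i, f i (p.1 i)
        ∂((Measure.pi fun _ => μ).prod (Measure.pi fun _ => μ)) =
      (Matrix.of fun i j => kernelPairing μ K (f i) (g j)).det := by
  simp only [prod_kernel_mul_alternant_mul_prod]
  exact (((measurePreserving_arrowProdEquivProdArrow X X (Fin n) (fun _ => μ)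
    fun _ => μ).symm _).integral_comp'
      fun q => (Matrix.of fun i j => K (q i).1 (q i).2 * (f i (q i).1 * g j (q i).2)).det).trans
    (integral_det_of_rows hint)

theorem prod_kernel_mul_alternant_permCoord (σ : Equiv.Perm (Fin n))
    (p : (Fin n → X) × (Fin n → X)) :
    (∏ i, K (permCoord σ p.1 i) (permCoord σ p.2 i)) * alternant g (permCoord σ p.2) =
      (Equiv.Perm.sign σ : ℤ) * ((∏ i, K (p.1 i) (p.2 i)) * alternant g p.2) := by
  rw [permCoord_apply, permCoord_apply, alternant_comp_perm,
    ← Equiv.prod_comp σ fun i => K (p.1 i) (p.2 i), mul_left_comm]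
  rfl

theorem integrable_prod_kernel_mul_alternant_mul_alternant
    (hint : ∀ i j, Integrable (fun q : X × X => K q.1 q.2 * (f i q.1 * g j q.2)) (μ.prod μ)) :
    Integrable (fun p : (Fin n → X) × (Fin n → X) =>
        (∏ i, K (p.1 i) (p.2 i)) * alternant g p.2 * alternant f p.1)
      ((Measure.pi fun _ => μ).prod (Measure.pi fun _ => μ)) :=
  integrable_mul_det (T := fun σ => (permCoord σ).prodCongr (permCoord σ))
    (M := fun p => Matrix.of fun i j => f j (p.1 i))
    (fun σ => (measurePreserving_permCoord μ σ).prod (measurePreserving_permCoord μ σ))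
    prod_kernel_mul_alternant_permCoord (fun _ _ => rfl)
    (integrable_prod_kernel_mul_alternant_mul_prod hint)

theorem integral_prod_kernel_mul_alternant_mul_alternant
    (hint : ∀ i j, Integrable (fun q : X × X => K q.1 q.2 * (f i q.1 * g j q.2)) (μ.prod μ)) :
    ∫ p, (∏ i, K (p.1 i) (p.2 i)) * alternant g p.2 * alternant f p.1
        ∂((Measure.pi fun _ => μ).prod (Measure.pi fun _ => μ)) =
      n.factorial * (Matrix.of fun i j => kernelPairing μ K (f i) (g j)).det := by
  refine (integral_mul_det (T := fun σ => (permCoord σ).prodCongr (permCoord σ))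
    (M := fun p => Matrix.of fun i j => f j (p.1 i))
    (fun σ => (measurePreserving_permCoord μ σ).prod (measurePreserving_permCoord μ σ))
    prod_kernel_mul_alternant_permCoord (fun _ _ => rfl)
    (integrable_prod_kernel_mul_alternant_mul_prod hint)).trans ?_
  rw [Fintype.card_fin]
  exact congrArg _ (integral_prod_kernel_mul_alternant_mul_prod hint)

theorem alternant_mul_alternant_permCoord (σ : Equiv.Perm (Fin n))
    (p : (Fin n → X) × (Fin n → X)) :
    alternant g p.2 * alternant f (permCoord σ p.1) =
      (Equiv.Perm.sign σ : ℤ) * (alternant g p.2 * alternant f p.1) := by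
  rw [permCoord_apply, alternant_comp_perm, mul_left_comm]

theorem integrable_alternant_mul_alternant_mul_det_kernelMatrix
    (hint : ∀ i j, Integrable (fun q : X × X => K q.1 q.2 * (f i q.1 * g j q.2)) (μ.prod μ)) :
    Integrable (fun p : (Fin n → X) × (Fin n → X) =>
        alternant g p.2 * alternant f p.1 * (kernelMatrix K p).det)
      ((Measure.pi fun _ => μ).prod (Measure.pi fun _ => μ)) := by
  have hdiag := integrable_prod_kernel_mul_alternant_mul_alternant hint
  simp only [prod_kernel_mul_alternant_mul_alternant] at hdiag
  exact integrable_mul_det (T := fun σ => (permCoord σ).prodCongr (MeasurableEquiv.refl _))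
    (M := kernelMatrix K)
    (fun σ => (measurePreserving_permCoord μ σ).prod (MeasurePreserving.id _))
    alternant_mul_alternant_permCoord (fun _ _ => rfl) hdiag

/-- A form of Andréief's identity. -/
theorem integral_alternant_mul_alternant_mul_det_kernelMatrix
    (hint : ∀ i j, Integrable (fun q : X × X => K q.1 q.2 * (f i q.1 * g j q.2)) (μ.prod μ)) :
    ∫ p, alternant g p.2 * alternant f p.1 * (kernelMatrix K p).det
        ∂((Measure.pi fun _ => μ).prod (Measure.pi fun _ => μ)) =
      (n.factorial : ℝ) ^ 2 * (Matrix.of fun i j => kernelPairing μ K (f i) (g j)).det := by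
  have hdiag := integrable_prod_kernel_mul_alternant_mul_alternant hint
  have hvalue := integral_prod_kernel_mul_alternant_mul_alternant hint
  simp only [prod_kernel_mul_alternant_mul_alternant] at hdiag hvalue
  refine (integral_mul_det (T := fun σ => (permCoord σ).prodCongr (MeasurableEquiv.refl _))
    (M := kernelMatrix K)
    (fun σ => (measurePreserving_permCoord μ σ).prod (MeasurePreserving.id _))
    alternant_mul_alternant_permCoord (fun _ _ => rfl) hdiag).trans ?_
  rw [hvalue, Fintype.card_fin]
  ring

end Andreief

section SkewKernels

variable {X : Type*} {S : X → X → ℝ} {n : ℕ}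

theorem abs_pairProd_le_one (hS : ∀ x y, |S x y| ≤ 1) (x : Fin n → X) : |pairProd S x| ≤ 1 := by
  simp only [pairProd, Finset.abs_prod]
  exact Finset.prod_le_one (fun _ _ => Finset.prod_nonneg fun _ _ => abs_nonneg _) fun _ _ =>
    Finset.prod_le_one (fun _ _ => abs_nonneg _) fun _ _ => hS _ _

variable [MeasurableSpace X]

theorem measurable_pairProd (hS : Measurable (Function.uncurry S)) :
    Measurable (pairProd S : (Fin n → X) → ℝ) :=
  Finset.measurable_prod _ fun i _ => Finset.measurable_prod _ fun j _ =>
    hS.comp (g := Function.uncurry S) (f := fun x : Fin n → X => (x i, x j))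
      ((measurable_pi_apply i).prodMk (measurable_pi_apply j))

/-- A measurable antisymmetric kernel bounded by one, so that its products integrate against any
product of integrable functions. -/
structure IsSkewKernel (S : X → X → ℝ) : Prop where
  measurable : Measurable (Function.uncurry S)
  antisymm : ∀ x y, S x y = -S y x
  abs_le_one : ∀ x y, |S x y| ≤ 1

/-- At `μ`-almost all points the product of `S` over the pairs satisfies the expansion along the
first row of the Pfaffian of the matrix `S (x i) (x j)`, bordered by ones when the number of points
is odd. -/
structure HasPfaffianExpansion (μ : Measure X) (S : X → X → ℝ) : Prop where
  even : ∀ {n : ℕ}, Even n → ∀ᵐ x ∂(Measure.pi fun _ : Fin (n + 2) => μ), pairProd S x =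
    ∑ j : Fin (n + 1), (-1) ^ (j : ℕ) * S (x 0) (x j.succ) *
      pairProd S fun k => x (j.succAbove k).succ
  odd : ∀ {n : ℕ}, Even n → ∀ᵐ x ∂(Measure.pi fun _ : Fin (n + 1) => μ), pairProd S x =
    ∑ j : Fin (n + 1), (-1) ^ (j : ℕ) * pairProd S fun k => x (j.succAbove k)

/-- The integral of `∏ i, g i (x i)` against the product of `S` over the pairs of points. -/
def pairIntegral (μ : Measure X) (S : X → X → ℝ) (g : Fin n → X → ℝ) : ℝ :=
  ∫ x, pairProd S x * ∏ i, g i (x i) ∂(Measure.pi fun _ => μ)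

variable {μ : Measure X}

namespace IsSkewKernel

theorem integrable_mul (hS : IsSkewKernel S) {f g : X → ℝ} (hf : Integrable f μ)
    (hg : Integrable g μ) : Integrable (fun p : X × X => S p.1 p.2 * (f p.1 * g p.2)) (μ.prod μ) :=
  (hf.mul_prod hg).bdd_mul (c := 1) hS.measurable.aestronglyMeasurable
    (Filter.Eventually.of_forall fun p => hS.abs_le_one p.1 p.2)

theorem integrable_one_add_mul (hS : IsSkewKernel S) {f g : X → ℝ} (hf : Integrable f μ)
    (hg : Integrable g μ) :
    Integrable (fun p : X × X => (1 + S p.1 p.2) * (f p.1 * g p.2)) (μ.prod μ) := by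
  simp only [add_mul, one_mul]
  exact (hf.mul_prod hg).add (hS.integrable_mul hf hg)

variable [SigmaFinite μ]

theorem kernelPairing_swap (hS : IsSkewKernel S) (f g : X → ℝ) :
    kernelPairing μ S g f = -kernelPairing μ S f g := by
  rw [kernelPairing, ← integral_prod_swap, kernelPairing, ← integral_neg]
  refine integral_congr_ae (Filter.Eventually.of_forall fun p => ?_)
  simp only [Prod.fst_swap, Prod.snd_swap, hS.antisymm p.2 p.1]
  ring

theorem integrable_pairProd_mul (hS : IsSkewKernel S) {g : Fin n → X → ℝ}
    (hg : ∀ i, Integrable (g i) μ) :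
    Integrable (fun x => pairProd S x * ∏ i, g i (x i)) (Measure.pi fun _ => μ) :=
  (Integrable.fintype_prod hg).bdd_mul (c := 1)
    (measurable_pairProd hS.measurable).aestronglyMeasurable
    (Filter.Eventually.of_forall fun _ => abs_pairProd_le_one hS.abs_le_one _)

theorem pairIntegral_comp_perm (hS : IsSkewKernel S) (g : Fin n → X → ℝ)
    (σ : Equiv.Perm (Fin n)) :
    pairIntegral μ S (g ∘ σ) = (Equiv.Perm.sign σ : ℤ) * pairIntegral μ S g := by
  rw [pairIntegral, ← (measurePreserving_permCoord μ σ).integral_comp', pairIntegral,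
    ← integral_const_mul]
  refine integral_congr_ae (Filter.Eventually.of_forall fun x => ?_)
  simp only [permCoord_apply, pairProd_comp_perm hS.antisymm, Function.comp_apply,
    Equiv.prod_comp σ fun i => g i (x i)]
  ring

theorem pairIntegral_eq_zero_of_eq (hS : IsSkewKernel S) {g : Fin n → X → ℝ} {i j : Fin n}
    (hij : i ≠ j) (hg : g i = g j) : pairIntegral μ S g = 0 := by
  have hswap := hS.pairIntegral_comp_perm (μ := μ) g (Equiv.swap i j)
  rw [Equiv.comp_swap_eq_update, hg, Function.update_eq_self, ← hg, Function.update_eq_self,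
    Equiv.Perm.sign_swap hij] at hswap
  push_cast at hswap
  linarith

theorem pairIntegral_expand_even (hS : IsSkewKernel S) (hexp : HasPfaffianExpansion μ S)
    (hn : Even n) {g : Fin (n + 2) → X → ℝ} (hg : ∀ i, Integrable (g i) μ) :
    pairIntegral μ S g = ∑ j : Fin (n + 1), (-1) ^ (j : ℕ) * kernelPairing μ S (g 0) (g j.succ) *
      pairIntegral μ S fun k => g (j.succAbove k).succ := by
  let H (j : Fin (n + 1)) (p : X × X) : ℝ := S p.1 p.2 * (g 0 p.1 * g j.succ p.2)
  let G (j : Fin (n + 1)) (x : Fin n → X) : ℝ := pairProd S x * ∏ k, g (j.succAbove k).succ (x k)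
  have hexpand : (fun x => pairProd S x * ∏ i, g i (x i)) =ᵐ[Measure.pi fun _ => μ] fun x =>
      ∑ j : Fin (n + 1), (-1) ^ (j : ℕ) *
        (H j (x 0, x j.succ) * G j fun k => x (j.succAbove k).succ) := by
    filter_upwards [hexp.even hn] with x hx
    rw [hx, Finset.sum_mul]
    refine Finset.sum_congr rfl fun j _ => ?_
    rw [Fin.prod_univ_succ, Fin.prod_univ_succAbove _ j]
    ring
  have hterm (j : Fin (n + 1)) := integrable_pi_mul_zero_succ (H := H j) (G := G j) j
    (hS.integrable_mul (hg 0) (hg j.succ))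
    (hS.integrable_pairProd_mul fun k => hg (j.succAbove k).succ)
  rw [pairIntegral, integral_congr_ae hexpand,
    integral_finsetSum _ fun j _ => (hterm j).const_mul _]
  refine Finset.sum_congr rfl fun j _ => ?_
  rw [integral_const_mul, integral_pi_mul_zero_succ j (H j) (G j), mul_assoc]
  rfl

theorem pairIntegral_expand_odd (hS : IsSkewKernel S) (hexp : HasPfaffianExpansion μ S)
    (hn : Even n) {g : Fin (n + 1) → X → ℝ} (hg : ∀ i, Integrable (g i) μ) :
    pairIntegral μ S g = ∑ j : Fin (n + 1), (-1) ^ (j : ℕ) * (∫ x, g j x ∂μ) *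
      pairIntegral μ S fun k => g (j.succAbove k) := by
  let G (j : Fin (n + 1)) (x : Fin n → X) : ℝ := pairProd S x * ∏ k, g (j.succAbove k) (x k)
  have hexpand : (fun x => pairProd S x * ∏ i, g i (x i)) =ᵐ[Measure.pi fun _ => μ] fun x =>
      ∑ j : Fin (n + 1), (-1) ^ (j : ℕ) * (g j (x j) * G j fun k => x (j.succAbove k)) := by
    filter_upwards [hexp.odd hn] with x hx
    rw [hx, Finset.sum_mul]
    refine Finset.sum_congr rfl fun j _ => ?_
    rw [Fin.prod_univ_succAbove _ j]
    ring
  have hterm (j : Fin (n + 1)) := integrable_pi_mul_succAbove (G := G j) j (hg j)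
    (hS.integrable_pairProd_mul fun k => hg (j.succAbove k))
  rw [pairIntegral, integral_congr_ae hexpand,
    integral_finsetSum _ fun j _ => (hterm j).const_mul _]
  refine Finset.sum_congr rfl fun j _ => ?_
  rw [integral_const_mul, integral_pi_mul_succAbove j (g j) (G j), mul_assoc]
  rfl

theorem isPfaffianFamily_pairIntegral (hS : IsSkewKernel S) (hexp : HasPfaffianExpansion μ S)
    {ι : Type*} {f : ι → X → ℝ} (hf : ∀ i, Integrable (f i) μ) :
    IsPfaffianFamily (Matrix.of fun i j => kernelPairing μ S (f i) (f j))
      (fun _ e => pairIntegral μ S (f ∘ e)) where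
  transpose_eq_neg := by ext i j; exact hS.kernelPairing_swap (f i) (f j)
  empty e := by simp [pairIntegral, pairProd, measureReal_def]
  expand hn e := hS.pairIntegral_expand_even hexp hn fun i => hf (e i)
  eq_zero_of_eq e j hj :=
    hS.pairIntegral_eq_zero_of_eq (Fin.succ_ne_zero j).symm (congrArg f hj)

theorem sq_pairIntegral_eq_det (hS : IsSkewKernel S) (hexp : HasPfaffianExpansion μ S)
    {f : Fin n → X → ℝ} (hf : ∀ i, Integrable (f i) μ) :
    pairIntegral μ S f ^ 2 = (Matrix.of fun i j =>
      kernelPairing μ S (f i) (f j) + (∫ x, f i x ∂μ) * ∫ x, f j x ∂μ).det := by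
  have hΦ := hS.isPfaffianFamily_pairIntegral hexp hf
  let u (i : Fin n) : ℝ := ∫ x, f i x ∂μ
  rcases n.even_or_odd with hn | hn
  · exact (hΦ.det_submatrix_add_vecMulVec_of_even hn u id).symm
  · obtain ⟨m, rfl⟩ : ∃ m, n = m + 1 := ⟨n - 1, (Nat.succ_pred_eq_of_pos hn.pos).symm⟩
    have hm : Even m := by simpa [Nat.odd_add_one] using hn
    refine Eq.trans ?_ (hΦ.det_submatrix_add_vecMulVec_of_odd hm u id).symm
    rw [hS.pairIntegral_expand_odd hexp hm hf]
    refine congrArg (· ^ 2) (Finset.sum_congr rfl fun j _ => ?_)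
    rw [mul_comm ((-1) ^ (j : ℕ)), mul_assoc]
    rfl

theorem kernelPairing_one_add (hS : IsSkewKernel S) {f g : X → ℝ} (hf : Integrable f μ)
    (hg : Integrable g μ) : kernelPairing μ (fun x y => 1 + S x y) f g =
      kernelPairing μ S f g + (∫ x, f x ∂μ) * ∫ x, g x ∂μ := by
  simp only [kernelPairing, add_mul, one_mul]
  rw [integral_add (hf.mul_prod hg) (hS.integrable_mul hf hg), integral_prod_mul, add_comm]

theorem integrable_pairProd_mul_alternant (hS : IsSkewKernel S) {f : Fin n → X → ℝ}
    (hf : ∀ i, Integrable (f i) μ) :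
    Integrable (fun x => pairProd S x * alternant f x) (Measure.pi fun _ => μ) :=
  integrable_mul_det (measurePreserving_permCoord μ)
    (fun σ => pairProd_comp_perm hS.antisymm σ) (fun _ _ => rfl) (hS.integrable_pairProd_mul hf)

theorem integral_pairProd_mul_alternant (hS : IsSkewKernel S) {f : Fin n → X → ℝ}
    (hf : ∀ i, Integrable (f i) μ) :
    ∫ x, pairProd S x * alternant f x ∂(Measure.pi fun _ => μ) =
      n.factorial * pairIntegral μ S f :=
  (integral_mul_det (measurePreserving_permCoord μ) (fun σ => pairProd_comp_perm hS.antisymm σ)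
    (fun _ _ => rfl) (hS.integrable_pairProd_mul hf)).trans (by rw [Fintype.card_fin]; rfl)

theorem sq_integral_pairProd_mul_alternant (hS : IsSkewKernel S)
    (hexp : HasPfaffianExpansion μ S) {f : Fin n → X → ℝ} (hf : ∀ i, Integrable (f i) μ) :
    (∫ x, pairProd S x * alternant f x ∂(Measure.pi fun _ => μ)) ^ 2 =
      ∫ p, alternant f p.2 * alternant f p.1 * (kernelMatrix (fun x y => 1 + S x y) p).det
        ∂((Measure.pi fun _ => μ).prod (Measure.pi fun _ => μ)) := by
  rw [hS.integral_pairProd_mul_alternant hf, mul_pow, hS.sq_pairIntegral_eq_det hexp hf,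
    integral_alternant_mul_alternant_mul_det_kernelMatrix fun i j =>
      hS.integrable_one_add_mul (hf i) (hf j)]
  simp only [hS.kernelPairing_one_add (hf _) (hf _)]

end IsSkewKernel

end SkewKernels

section SchurKernel

variable {n : ℕ}

/-- The kernel `(y - x) / (y + x)` of the Schur Pfaffian. The absolute values extend it from the
positive quadrant to a kernel on the whole plane that is still antisymmetric and bounded by one. -/
def schurKernel (x y : ℝ) : ℝ :=
  (y - x) / (|x| + |y|)

theorem schurKernel_of_nonneg {x y : ℝ} (hx : 0 ≤ x) (hy : 0 ≤ y) :
    schurKernel x y = (y - x) / (y + x) := by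
  rw [schurKernel, abs_of_nonneg hx, abs_of_nonneg hy, add_comm]

theorem schurKernel_ne_zero {x y : ℝ} (hxy : x ≠ y) : schurKernel x y ≠ 0 := by
  refine div_ne_zero (sub_ne_zero.2 hxy.symm) fun hadd => hxy ?_
  rw [abs_eq_zero.1 (by linarith [abs_nonneg x, abs_nonneg y] : |x| = 0),
    abs_eq_zero.1 (by linarith [abs_nonneg x, abs_nonneg y] : |y| = 0)]

theorem schurKernel_zero_left {y : ℝ} (hy : 0 < y) : schurKernel 0 y = 1 := by
  rw [schurKernel_of_nonneg le_rfl hy.le, sub_zero, add_zero, div_self hy.ne']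

theorem one_add_schurKernel {x y : ℝ} (hx : 0 < x) (hy : 0 < y) :
    1 + schurKernel x y = 2 * y * (x + y)⁻¹ := by
  have := (add_pos hy hx).ne'
  rw [schurKernel_of_nonneg hx.le hy.le, add_comm x y]
  field_simp
  ring

theorem isSkewKernel_schurKernel : IsSkewKernel schurKernel where
  measurable := by unfold Function.uncurry schurKernel; fun_prop
  antisymm x y := by rw [schurKernel, schurKernel, add_comm |y|]; ring
  abs_le_one x y := by
    rw [schurKernel, abs_div, abs_of_nonneg (a := |x| + |y|) (by positivity)]
    exact div_le_one_of_le₀ ((abs_sub y x).trans_eq (add_comm _ _)) (by positivity)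

/-- The identity `∑ i, ∏ k ≠ i, (z i + z k) / (z i - z k) = 0` with the sign of the first point
reversed. -/
theorem prod_schurKernel_zero_succ (hn : Even n) {x : Fin (n + 2) → ℝ} (hx : ∀ i, 0 ≤ x i)
    (hinj : Function.Injective x) :
    ∏ k : Fin (n + 1), schurKernel (x 0) (x k.succ) =
      ∑ j : Fin (n + 1), schurKernel (x 0) (x j.succ) *
        ∏ k : Fin n, (schurKernel (x j.succ) (x (j.succAbove k).succ))⁻¹ := by
  let z : Fin (n + 2) → ℝ := Fin.cons (-x 0) fun k : Fin (n + 1) => x k.succ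
  have hz : Function.Injective z := by
    refine Fin.cons_injective_iff.2 ⟨?_, hinj.comp (Fin.succ_injective _)⟩
    rintro ⟨k, hk : x k.succ = -x 0⟩
    exact Fin.succ_ne_zero k (hinj (by linarith [hx 0, hx k.succ, hk]))
  have hzero (k : Fin (n + 1)) :
      (-x 0 + x k.succ) / (-x 0 - x k.succ) = -schurKernel (x 0) (x k.succ) := by
    rw [schurKernel_of_nonneg (hx _) (hx _), ← neg_div_neg_eq]
    ring
  have hsucc (j k : Fin (n + 1)) : (x j.succ + x k.succ) / (x j.succ - x k.succ) =
      -(schurKernel (x j.succ) (x k.succ))⁻¹ := by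
    rw [schurKernel_of_nonneg (hx _) (hx _), inv_div, ← neg_div_neg_eq]
    ring
  have hreversed (j : Fin (n + 1)) : (x j.succ + -x 0) / (x j.succ - -x 0) =
      schurKernel (x 0) (x j.succ) := by
    rw [schurKernel_of_nonneg (hx _) (hx _)]
    ring
  have hsum := sum_prod_succAbove_add_div_sub_eq_zero hn hz
  simp only [Fin.sum_univ_succ (n := n + 1), Fin.prod_univ_succ (n := n),
    Fin.zero_succAbove, Fin.succ_succAbove_zero, Fin.succ_succAbove_succ, z, Fin.cons_zero,
    Fin.cons_succ, hzero, hsucc, hreversed, Finset.prod_neg, Finset.card_fin,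
    hn.neg_one_pow, one_mul] at hsum
  rw [Fin.prod_univ_succ]
  linear_combination -hsum

theorem pairProd_schurKernel_expand_even (hn : Even n) {x : Fin (n + 2) → ℝ} (hx : ∀ i, 0 ≤ x i)
    (hinj : Function.Injective x) :
    pairProd schurKernel x = ∑ j : Fin (n + 1), (-1) ^ (j : ℕ) * schurKernel (x 0) (x j.succ) *
      pairProd schurKernel fun k => x (j.succAbove k).succ := by
  rw [pairProd_succ, prod_schurKernel_zero_succ hn hx hinj, Finset.sum_mul]
  refine Finset.sum_congr rfl fun j _ => ?_
  rw [pairProd_eq_extract isSkewKernel_schurKernel.antisymm (fun k : Fin (n + 1) => x k.succ) j,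
    Finset.prod_inv_distrib]
  have hne : ∏ k : Fin n, schurKernel (x j.succ) (x (j.succAbove k).succ) ≠ 0 :=
    Finset.prod_ne_zero_iff.2 fun k _ => schurKernel_ne_zero fun h =>
      Fin.succAbove_ne j k (Fin.succ_injective _ (hinj h)).symm
  field_simp

/-- A point at the origin contributes only factors `1`, which reduces the odd case to the even
one. -/
theorem pairProd_schurKernel_expand_odd (hn : Even n) {x : Fin (n + 1) → ℝ} (hx : ∀ i, 0 < x i)
    (hinj : Function.Injective x) :
    pairProd schurKernel x = ∑ j : Fin (n + 1), (-1) ^ (j : ℕ) *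
      pairProd schurKernel fun k => x (j.succAbove k) := by
  let x₀ : Fin (n + 2) → ℝ := Fin.cons 0 x
  have hinj₀ : Function.Injective x₀ :=
    Fin.cons_injective_iff.2 ⟨fun ⟨k, hk⟩ => (hx k).ne' hk, hinj⟩
  have hexpand := pairProd_schurKernel_expand_even hn (x := x₀)
    (Fin.cases le_rfl fun k => (hx k).le) hinj₀
  simpa only [pairProd_succ, x₀, Fin.cons_zero, Fin.cons_succ, schurKernel_zero_left (hx _),
    Finset.prod_const_one, one_mul, mul_one] using hexpand

end SchurKernel

section Laguerre

variable {a θ : ℝ} {n : ℕ}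

/-- Lebesgue measure on the positive half-line, whose powers are the measures on the orthants. -/
abbrev volumePos : Measure ℝ :=
  volume.restrict (Set.Ioi 0)

theorem volume_restrict_orthant (n : ℕ) :
    (volume : Measure (Fin n → ℝ)).restrict (orthant n) = Measure.pi fun _ => volumePos := by
  rw [orthant, volume_pi, Measure.restrict_pi_pi]

theorem volume_restrict_orthant_prod (n : ℕ) :
    (volume : Measure ((Fin n → ℝ) × (Fin n → ℝ))).restrict (orthant n ×ˢ orthant n) =
      (Measure.pi fun _ => volumePos).prod (Measure.pi fun _ => volumePos) := by
  rw [Measure.volume_eq_prod, ← Measure.prod_restrict, volume_restrict_orthant]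

theorem volume_restrict_quadrant :
    (volume : Measure (ℝ × ℝ)).restrict quadrant = volumePos.prod volumePos := by
  rw [quadrant, Measure.volume_eq_prod, ← Measure.prod_restrict]

theorem measurableSet_orthant (n : ℕ) : MeasurableSet (orthant n) :=
  MeasurableSet.univ_pi fun _ => measurableSet_Ioi

theorem measurableSet_quadrant : MeasurableSet quadrant :=
  measurableSet_Ioi.prod measurableSet_Ioi

theorem mem_orthant {x : Fin n → ℝ} : x ∈ orthant n ↔ ∀ i, 0 < x i := by
  simp [orthant]

theorem hasPfaffianExpansion_schurKernel : HasPfaffianExpansion volumePos schurKernel := by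
  have hpos (n : ℕ) : ∀ᵐ x ∂(Measure.pi fun _ : Fin n => volumePos), ∀ i, 0 < x i := by
    rw [← volume_restrict_orthant]
    filter_upwards [ae_restrict_mem (measurableSet_orthant n)] with x hx using mem_orthant.1 hx
  refine ⟨fun hn => ?_, fun hn => ?_⟩
  · filter_upwards [hpos _, ae_injective_pi volumePos] with x hx hinj
    exact pairProd_schurKernel_expand_even hn (fun i => (hx i).le) hinj
  · filter_upwards [hpos _, ae_injective_pi volumePos] with x hx hinj
    exact pairProd_schurKernel_expand_odd hn hx hinj

/-- The Laguerre weight `x ^ s * exp (-x)`. -/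
def laguerre (s x : ℝ) : ℝ :=
  x ^ s * Real.exp (-x)

/-- The Laguerre weights with exponents `a, a + θ, a + 2θ, …`. -/
def laguerreFamily (a θ : ℝ) (i : Fin n) : ℝ → ℝ :=
  laguerre (a + θ * (i : ℕ))

theorem integrable_laguerre {s : ℝ} (hs : -1 < s) : Integrable (laguerre s) volumePos := by
  refine (Real.GammaIntegral_convergent (s := s + 1) (by linarith)).congr
    (Filter.Eventually.of_forall fun x => ?_)
  simp [laguerre, mul_comm]

theorem integrable_laguerre_add_mul (ha : -1 < a) (hθ : 0 ≤ θ) {t : ℝ} (ht : 0 ≤ t) :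
    Integrable (laguerre (a + θ * t)) volumePos :=
  integrable_laguerre (by linarith [mul_nonneg hθ ht])

theorem integrable_laguerreFamily (ha : -1 < a) (hθ : 0 ≤ θ) (i : Fin n) :
    Integrable (laguerreFamily a θ i) volumePos :=
  integrable_laguerre_add_mul ha hθ (Nat.cast_nonneg _)

theorem alternant_laguerreFamily (a θ : ℝ) {x : Fin n → ℝ} (hx : ∀ i, 0 < x i) :
    alternant (laguerreFamily a θ) x =
      (∏ i, x i ^ a * Real.exp (-x i)) * ∏ i, ∏ j ∈ Finset.Ioi i, (x j ^ θ - x i ^ θ) := by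
  rw [alternant, ← Matrix.det_vandermonde fun i => x i ^ θ, ← Matrix.det_mul_column]
  congr 1
  ext i j
  rw [Matrix.of_apply, Matrix.of_apply, Matrix.vandermonde_apply, laguerreFamily, laguerre,
    Real.rpow_add (hx i), Real.rpow_mul (hx i).le, Real.rpow_natCast]
  ring

theorem det_kernelMatrix_one_add_schurKernel {p : (Fin n → ℝ) × (Fin n → ℝ)}
    (hx : ∀ i, 0 < p.1 i) (hy : ∀ i, 0 < p.2 i) :
    (kernelMatrix (fun x y => 1 + schurKernel x y) p).det =
      (∏ j, 2 * p.2 j) * ((∏ i, ∏ j ∈ Finset.Ioi i, (p.1 j - p.1 i) * (p.2 j - p.2 i)) /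
        ∏ i, ∏ j, (p.1 i + p.2 j)) := by
  rw [← det_cauchy p.1 p.2 fun i j => (add_pos (hx i) (hy j)).ne', ← Matrix.det_mul_row]
  congr 1
  ext i j
  exact one_add_schurKernel (hx i) (hy j)

theorem buresDensity_ae_eq (n : ℕ) (a θ : ℝ) :
    buresDensity n a θ =ᵐ[Measure.pi fun _ => volumePos]
      fun x => pairProd schurKernel x * alternant (laguerreFamily a θ) x := by
  rw [← volume_restrict_orthant]
  filter_upwards [ae_restrict_mem (measurableSet_orthant n)] with x hx
  have hx := mem_orthant.1 hx
  rw [alternant_laguerreFamily a θ hx, buresDensity, pairProd]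
  simp only [Finset.prod_mul_distrib, schurKernel_of_nonneg (hx _).le (hx _).le]
  ring

theorem two_pow_mul_cauchyDensity_ae_eq (n : ℕ) (a θ : ℝ) :
    (fun p => 2 ^ n * cauchyDensity n a (a + 1) θ p)
      =ᵐ[(Measure.pi fun _ => volumePos).prod (Measure.pi fun _ => volumePos)]
      fun p => alternant (laguerreFamily a θ) p.2 * alternant (laguerreFamily a θ) p.1 *
        (kernelMatrix (fun x y => 1 + schurKernel x y) p).det := by
  rw [← volume_restrict_orthant_prod]
  filter_upwards [ae_restrict_mem ((measurableSet_orthant n).prod (measurableSet_orthant n))]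
    with p hp
  have hx := mem_orthant.1 hp.1
  have hy := mem_orthant.1 hp.2
  rw [alternant_laguerreFamily a θ hx, alternant_laguerreFamily a θ hy,
    det_kernelMatrix_one_add_schurKernel hx hy, cauchyDensity]
  simp only [Real.rpow_add_one (hy _).ne', Finset.prod_mul_distrib, Fin.prod_const]
  ring

theorem integrableOn_buresDensity (ha : -1 < a) (hθ : 0 ≤ θ) (n : ℕ) :
    IntegrableOn (buresDensity n a θ) (orthant n) := by
  rw [IntegrableOn, volume_restrict_orthant, integrable_congr (buresDensity_ae_eq n a θ)]
  exact isSkewKernel_schurKernel.integrable_pairProd_mul_alternant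
    (integrable_laguerreFamily ha hθ)

theorem integrableOn_cauchyDensity (ha : -1 < a) (hθ : 0 ≤ θ) (n : ℕ) :
    IntegrableOn (cauchyDensity n a (a + 1) θ) (orthant n ×ˢ orthant n) := by
  rw [IntegrableOn, volume_restrict_orthant_prod,
    ← integrable_const_mul_iff (IsUnit.mk0 ((2 : ℝ) ^ n) (by positivity)),
    integrable_congr (two_pow_mul_cauchyDensity_ae_eq n a θ)]
  exact integrable_alternant_mul_alternant_mul_det_kernelMatrix fun i j =>
    isSkewKernel_schurKernel.integrable_one_add_mul (integrable_laguerreFamily ha hθ i)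
      (integrable_laguerreFamily ha hθ j)

theorem buresZ_sq (ha : -1 < a) (hθ : 0 ≤ θ) (n : ℕ) :
    buresZ n a θ ^ 2 = 2 ^ n * cauchyZ n a (a + 1) θ := by
  have hsq := isSkewKernel_schurKernel.sq_integral_pairProd_mul_alternant
    hasPfaffianExpansion_schurKernel (integrable_laguerreFamily (n := n) ha hθ)
  rw [buresZ, cauchyZ, volume_restrict_orthant, integral_congr_ae (buresDensity_ae_eq n a θ),
    mul_pow, hsq, mul_left_comm, ← integral_const_mul ((2 : ℝ) ^ n),
    volume_restrict_orthant_prod, integral_congr_ae (two_pow_mul_cauchyDensity_ae_eq n a θ)]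

theorem buresMomentIntegrand_ae_eq (a θ : ℝ) (j k : ℕ) :
    buresMomentIntegrand a θ j k =ᵐ[volumePos.prod volumePos] fun p => schurKernel p.1 p.2 *
      (laguerre (a + θ * ((j : ℝ) - 1)) p.1 * laguerre (a + θ * ((k : ℝ) - 1)) p.2) := by
  rw [← volume_restrict_quadrant]
  filter_upwards [ae_restrict_mem measurableSet_quadrant] with p hp
  rw [schurKernel_of_nonneg (le_of_lt hp.1) (le_of_lt hp.2), buresMomentIntegrand, laguerre,
    laguerre, neg_add, Real.exp_add]
  ring

theorem two_mul_cauchyMomentIntegrand_ae_eq (a θ : ℝ) (j k : ℕ) :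
    (fun p => 2 * cauchyMomentIntegrand a (a + 1) θ j k p) =ᵐ[volumePos.prod volumePos]
      fun p => (1 + schurKernel p.1 p.2) *
        (laguerre (a + θ * ((j : ℝ) - 1)) p.1 * laguerre (a + θ * ((k : ℝ) - 1)) p.2) := by
  rw [← volume_restrict_quadrant]
  filter_upwards [ae_restrict_mem measurableSet_quadrant] with p hp
  rw [one_add_schurKernel hp.1 hp.2, cauchyMomentIntegrand, laguerre, laguerre, neg_add,
    Real.exp_add, add_right_comm a 1, Real.rpow_add_one (ne_of_gt hp.2)]
  ring

variable {j k : ℕ}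

theorem integrableOn_buresSingleIntegrand (ha : -1 < a) (hθ : 0 ≤ θ) (hj : 1 ≤ j) :
    IntegrableOn (buresSingleIntegrand a θ j) (Set.Ioi 0) :=
  integrable_laguerre_add_mul ha hθ (sub_nonneg.2 (Nat.one_le_cast.2 hj))

theorem integrableOn_buresMomentIntegrand (ha : -1 < a) (hθ : 0 ≤ θ) (hj : 1 ≤ j) (hk : 1 ≤ k) :
    IntegrableOn (buresMomentIntegrand a θ j k) quadrant := by
  rw [IntegrableOn, volume_restrict_quadrant,
    integrable_congr (buresMomentIntegrand_ae_eq a θ j k)]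
  exact isSkewKernel_schurKernel.integrable_mul (integrableOn_buresSingleIntegrand ha hθ hj)
    (integrableOn_buresSingleIntegrand ha hθ hk)

theorem integrableOn_cauchyMomentIntegrand (ha : -1 < a) (hθ : 0 ≤ θ) (hj : 1 ≤ j)
    (hk : 1 ≤ k) : IntegrableOn (cauchyMomentIntegrand a (a + 1) θ j k) quadrant := by
  rw [IntegrableOn, volume_restrict_quadrant,
    ← integrable_const_mul_iff (IsUnit.mk0 (2 : ℝ) two_ne_zero),
    integrable_congr (two_mul_cauchyMomentIntegrand_ae_eq a θ j k)]
  exact isSkewKernel_schurKernel.integrable_one_add_mul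
    (integrableOn_buresSingleIntegrand ha hθ hj) (integrableOn_buresSingleIntegrand ha hθ hk)

theorem two_mul_cauchyMoment (ha : -1 < a) (hθ : 0 ≤ θ) (hj : 1 ≤ j) (hk : 1 ≤ k) :
    2 * cauchyMoment a (a + 1) θ j k =
      buresMoment a θ j k + buresSingleMoment a θ j * buresSingleMoment a θ k := by
  rw [cauchyMoment, ← integral_const_mul, buresMoment, volume_restrict_quadrant,
    integral_congr_ae (two_mul_cauchyMomentIntegrand_ae_eq a θ j k),
    integral_congr_ae (buresMomentIntegrand_ae_eq a θ j k)]
  exact isSkewKernel_schurKernel.kernelPairing_one_add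
    (integrableOn_buresSingleIntegrand ha hθ hj) (integrableOn_buresSingleIntegrand ha hθ hk)

end Laguerre

end ThetaEnsemble

end

theorem mainTheorem9 (a θ : ℝ) (ha : -1 < a) (hθ : 0 < θ) :
    (∀ N : ℕ,
      IntegrableOn (ThetaEnsemble.buresDensity N a θ) (ThetaEnsemble.orthant N) ∧
      IntegrableOn (ThetaEnsemble.cauchyDensity N a (a + 1) θ)
        (ThetaEnsemble.orthant N ×ˢ ThetaEnsemble.orthant N) ∧
      ThetaEnsemble.buresZ N a θ ^ 2 = 2 ^ N * ThetaEnsemble.cauchyZ N a (a + 1) θ) ∧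
    (∀ j k : ℕ, 1 ≤ j → 1 ≤ k →
      IntegrableOn (ThetaEnsemble.cauchyMomentIntegrand a (a + 1) θ j k)
        ThetaEnsemble.quadrant ∧
      IntegrableOn (ThetaEnsemble.buresMomentIntegrand a θ j k) ThetaEnsemble.quadrant ∧
      IntegrableOn (ThetaEnsemble.buresSingleIntegrand a θ j) (Set.Ioi 0) ∧
      2 * ThetaEnsemble.cauchyMoment a (a + 1) θ j k =
        ThetaEnsemble.buresMoment a θ j k +
          ThetaEnsemble.buresSingleMoment a θ j * ThetaEnsemble.buresSingleMoment a θ k) :=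
  open ThetaEnsemble in
  ⟨fun N => ⟨integrableOn_buresDensity ha hθ.le N, integrableOn_cauchyDensity ha hθ.le N,
      buresZ_sq ha hθ.le N⟩,
    fun _ _ hj hk => ⟨integrableOn_cauchyMomentIntegrand ha hθ.le hj hk,
      integrableOn_buresMomentIntegrand ha hθ.le hj hk,
      integrableOn_buresSingleIntegrand ha hθ.le hj, two_mul_cauchyMoment ha hθ.le hj hk⟩⟩
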